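/- **Conventions.** A *quantaloid* is a category whose hom-sets are complete lattices such that composition preserves arbitrary joins in each variable; it is *small* if its objects form a set. For arrows $f:X\to Y$, $g:Y\to Z$, $h:X\to Z$ the implications $h\swarrow f:Y\to Z$ and $g\searrow h:X\to Y$ are determined by $g\circ f\le h\iff g\le h\swarrow f\iff f\le g\searrow h$. A *homomorphism of quantaloids* is a functor preserving arbitrary joins of arrows; it is an *equivalence of quantaloids* if it is moreover an equivalence of the underlying categories. The opposite of a quantaloid keeps the local order. Let $\mathcal C$ be a quantaloid. A *Chu connection* from $f:X_1\to Y_1$ to $g:X_2\to Y_2$ is a pair $(u:X_1\to X_2,\ v:Y_1\to Y_2)$ with $f\swarrow u=v\searrow g$. The arrows of $\mathcal C$ and the Chu connections, with componentwise composition and order, form a quantaloid $\mathbf{ChuCon}(\mathcal C)$. Put $(u,v)\sim(u',v')$ if $f\swarrow u=f\swarrow u'$. This is a congruence (compatible with composition and joins), and $\mathbf B(\mathcal C):=\mathbf{ChuCon}(\mathcal C)/{\sim}$ is the quantaloid of *back diagonals*, with quotient homomorphism $\sigma:\mathbf{ChuCon}(\mathcal C)\to\mathbf B(\mathcal C)$.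 Let $\mathcal Q$ be a small quantaloid. A $\mathcal Q$-*category* $\mathbb A$ is a set of objects $x$, each with a type $tx\in\operatorname{ob}\mathcal Q$, and arrows $\mathbb A(x,y):tx\to ty$ with $1_{tx}\le\mathbb A(x,x)$ and $\mathbb A(y,z)\circ\mathbb A(x,y)\le\mathbb A(x,z)$. Its underlying preorder is given by $x\le y$ iff $tx=ty$ and $1_{tx}\le\mathbb A(x,y)$; $\mathbb A$ is *skeletal* if this is a partial order. A $\mathcal Q$-*distributor* $\phi:\mathbb A\to\mathbb B$ is a family of arrows $\phi(x,y):tx\to ty$ with $\mathbb B(y,y')\circ\phi(x,y)\circ\mathbb A(x',x)\le\phi(x',y')$. With $(\psi\circ\phi)(x,z)=\bigvee_y\psi(y,z)\circ\phi(x,y)$, the pointwise order, and $\mathbb A$ itself as the identity on $\mathbb A$, the $\mathcal Q$-categories and $\mathcal Q$-distributors form a quantaloid $\mathcal Q\text{-}\mathbf{Dist}$. A $\mathcal Q$-*functor* $F:\mathbb A\to\mathbb B$ is a type-preserving map on objects with $\mathbb A(x,y)\le\mathbb B(Fx,Fy)$; $\mathcal Q$-functors are ordered pointwise, and $F\dashv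 G$ means $1\le GF$ and $FG\le 1$. A *presheaf* of type $X$ on $\mathbb A$ is a distributor $\mu:\mathbb A\to *_X$, where $*_X$ has a single object, of type $X$, and hom-arrow $1_X$. The presheaves form a $\mathcal Q$-category $\mathsf P\mathbb A$ with $\mathsf P\mathbb A(\mu,\mu')=\mu'\swarrow\mu$. $\mathbb A$ is *complete* if the Yoneda embedding $\mathbb A\to\mathsf P\mathbb A$, $x\mapsto\mathbb A(-,x)$, has a left adjoint $\mathcal Q$-functor. Skeletal complete $\mathcal Q$-categories and left adjoint $\mathcal Q$-functors, ordered pointwise, form a quantaloid $\mathcal Q\text{-}\mathbf{CCat}$. For a distributor $\phi:\mathbb A\to\mathbb B$ let $\mathsf M\phi$ be the full $\mathcal Q$-subcategory of $\mathsf P\mathbb A$ on the presheaves $\mu$ with $(\phi\swarrow\mu)\searrow\phi=\mu$. For a Chu connection $(\zeta,\eta)$ in $\mathcal Q\text{-}\mathbf{Dist}$ from $\phi:\mathbb A\to\mathbb B$ to $\psi:\mathbb A'\to\mathbb B'$ let $$\mathsf M(\zeta,\eta):\mathsf M\psi\to\mathsf M\phi,\qquad \mu'\mapsto(\phi\swarrow(\mu'\circ\zeta))\searrow\phi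 .$$ This defines a functor $\mathsf M:\mathbf{ChuCon}(\mathcal Q\text{-}\mathbf{Dist})^{\mathrm{op}}\to\mathcal Q\text{-}\mathbf{CCat}$. **Theorem.** Let $\mathcal Q$ be a small quantaloid. There is a unique functor $\mathsf M_b:\mathbf B(\mathcal Q\text{-}\mathbf{Dist})^{\mathrm{op}}\to\mathcal Q\text{-}\mathbf{CCat}$ with $\mathsf M_b\circ\sigma^{\mathrm{op}}=\mathsf M$, and $\mathsf M_b$ is an equivalence of quantaloids. Hence $\mathbf B(\mathcal Q\text{-}\mathbf{Dist})$ and $\mathcal Q\text{-}\mathbf{CCat}$ are dually equivalent quantaloids: there is an equivalence of categories between $\mathbf B(\mathcal Q\text{-}\mathbf{Dist})^{\mathrm{op}}$ and $\mathcal Q\text{-}\mathbf{CCat}$ such that the functors in both directions are homomorphisms of quantaloids. -/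

import Mathlib

open CategoryTheory Opposite

universe v u v' u'

/-! ### Quantaloids -/

/-- A quantaloid: a category whose hom-sets are complete lattices such that composition
preserves arbitrary joins in each variable. -/
class Quantaloid (C : Type u) [Category.{v} C] where
  homLattice : ∀ X Y : C, CompleteLattice (X ⟶ Y)
  sSup_comp : ∀ {X Y Z : C} (S : Set (X ⟶ Y)) (g : Y ⟶ Z),
    sSup S ≫ g = sSup ((fun f => f ≫ g) '' S)
  comp_sSup : ∀ {X Y Z : C} (f : X ⟶ Y) (S : Set (Y ⟶ Z)),
    f ≫ sSup S = sSup ((fun g => f ≫ g) '' S)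

attribute [reducible] Quantaloid.homLattice

attribute [instance] Quantaloid.homLattice

/-- A homomorphism of quantaloids is a functor that preserves joins of arrows. -/
def IsQuantaloidHom {C : Type u} [Category.{v} C] [Quantaloid C]
    {D : Type u'} [Category.{v'} D] [Quantaloid D] (F : C ⥤ D) : Prop :=
  ∀ (X Y : C) (S : Set (X ⟶ Y)), F.map (sSup S) = sSup ((fun f => F.map f) '' S)

/-- An equivalence of quantaloids is a homomorphism of quantaloids that is an equivalence of
the underlying categories. -/
def IsQuantaloidEquivalence {C : Type u} [Category.{v} C] [Quantaloid C]
    {D : Type u'} [Category.{v'} D] [Quantaloid D] (F : C ⥤ D) : Prop :=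
  IsQuantaloidHom F ∧ F.IsEquivalence

namespace Quantaloid

section Basic

variable {C : Type u} [Category.{v} C] [Quantaloid C]

theorem iSup_comp {ι : Sort*} {X Y Z : C} (f : ι → (X ⟶ Y)) (g : Y ⟶ Z) :
    (⨆ i, f i) ≫ g = ⨆ i, f i ≫ g := by
  rw [iSup, sSup_comp, iSup, ← Set.range_comp]; rfl

theorem comp_iSup {ι : Sort*} {X Y Z : C} (f : X ⟶ Y) (g : ι → (Y ⟶ Z)) :
    f ≫ (⨆ i, g i) = ⨆ i, f ≫ g i := by
  rw [iSup, comp_sSup, iSup, ← Set.range_comp]; rfl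

theorem comp_mono {X Y Z : C} {f f' : X ⟶ Y} {g g' : Y ⟶ Z} (hf : f ≤ f') (hg : g ≤ g') :
    f ≫ g ≤ f' ≫ g' := by
  have h1 : f ≫ g ≤ f' ≫ g := by
    have := sSup_comp {f, f'} g
    rw [sSup_pair, sup_eq_right.mpr hf, Set.image_pair, sSup_pair] at this
    rw [this]; exact le_sup_left
  have h2 : f' ≫ g ≤ f' ≫ g' := by
    have := comp_sSup f' {g, g'}
    rw [sSup_pair, sup_eq_right.mpr hg, Set.image_pair, sSup_pair] at this
    rw [this]; exact le_sup_left
  exact h1.trans h2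

/-- The left implication `h ↙ f`, right adjoint to `g ↦ g ∘ f`. -/
def lda {X Y Z : C} (h : X ⟶ Z) (f : X ⟶ Y) : Y ⟶ Z := sSup {g | f ≫ g ≤ h}

/-- The right implication `g ↘ h`, right adjoint to `f ↦ g ∘ f`. -/
def rda {X Y Z : C} (g : Y ⟶ Z) (h : X ⟶ Z) : X ⟶ Y := sSup {f | f ≫ g ≤ h}

theorem le_lda {X Y Z : C} {f : X ⟶ Y} {g : Y ⟶ Z} {h : X ⟶ Z} :
    g ≤ lda h f ↔ f ≫ g ≤ h := by
  refine ⟨fun H => (comp_mono le_rfl H).trans ?_, fun H => le_sSup H⟩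
  rw [lda, comp_sSup]
  exact sSup_le (by rintro _ ⟨k, hk, rfl⟩; exact hk)

theorem le_rda {X Y Z : C} {f : X ⟶ Y} {g : Y ⟶ Z} {h : X ⟶ Z} :
    f ≤ rda g h ↔ f ≫ g ≤ h := by
  refine ⟨fun H => (comp_mono H le_rfl).trans ?_, fun H => le_sSup H⟩
  rw [rda, sSup_comp]
  exact sSup_le (by rintro _ ⟨k, hk, rfl⟩; exact hk)

theorem comp_lda_le {X Y Z : C} (h : X ⟶ Z) (f : X ⟶ Y) : f ≫ lda h f ≤ h := le_lda.mp le_rfl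

theorem rda_comp_le {X Y Z : C} (g : Y ⟶ Z) (h : X ⟶ Z) : rda g h ≫ g ≤ h := le_rda.mp le_rfl

theorem lda_comp {X Y Z W : C} (h : X ⟶ W) (f : X ⟶ Y) (g : Y ⟶ Z) :
    lda h (f ≫ g) = lda (lda h f) g :=
  eq_of_forall_le_iff fun k => by simp only [le_lda, Category.assoc]

theorem rda_comp {X Y Z W : C} (f : Y ⟶ Z) (g : Z ⟶ W) (h : X ⟶ W) :
    rda (f ≫ g) h = rda f (rda g h) :=
  eq_of_forall_le_iff fun k => by simp only [le_rda, Category.assoc]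

theorem lda_rda {X Y Z W : C} (v : Y ⟶ Z) (g : X ⟶ Z) (u : X ⟶ W) :
    lda (rda v g) u = rda v (lda g u) :=
  eq_of_forall_le_iff fun k => by simp only [le_rda, le_lda, Category.assoc]

end Basic

/-! ### The opposite quantaloid -/

section Op

variable (C : Type u) [Category.{v} C] [Quantaloid C]

/-- The opposite of a quantaloid: arrows are reversed, the local order is kept. -/
instance instOp : Quantaloid Cᵒᵖ where
  homLattice X Y :=
    letI : PartialOrder (X ⟶ Y) := PartialOrder.lift Quiver.Hom.unop Quiver.Hom.unop_inj
    letI : SupSet (X ⟶ Y) := ⟨fun S => (sSup (Quiver.Hom.unop '' S)).op⟩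
    completeLatticeOfSup _ fun S =>
      ⟨fun f hf => (le_sSup (Set.mem_image_of_mem Quiver.Hom.unop hf) :
          f.unop ≤ sSup (Quiver.Hom.unop '' S)),
        fun g hg => (sSup_le (by rintro _ ⟨f, hf, rfl⟩; exact hg hf) :
          sSup (Quiver.Hom.unop '' S) ≤ g.unop)⟩
  sSup_comp S g := by
    refine Quiver.Hom.unop_inj ?_
    change g.unop ≫ sSup _ = sSup _
    rw [comp_sSup, Set.image_image, Set.image_image]; rfl
  comp_sSup f S := by
    refine Quiver.Hom.unop_inj ?_
    change sSup _ ≫ f.unop = sSup _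
    rw [sSup_comp, Set.image_image, Set.image_image]; rfl

end Op

/-! ### Congruences and quotient quantaloids -/

/-- A congruence on a quantaloid: equivalence relations on the hom-sets, compatible with
composition and with arbitrary joins. -/
structure Congruence (C : Type u) [Category.{v} C] [Quantaloid C] where
  rel : ∀ {X Y : C}, (X ⟶ Y) → (X ⟶ Y) → Prop
  equivalence : ∀ X Y : C, Equivalence (rel (X := X) (Y := Y))
  comp : ∀ {X Y Z : C} {f f' : X ⟶ Y} {g g' : Y ⟶ Z},
    rel f f' → rel g g' → rel (f ≫ g) (f' ≫ g')
  iSup : ∀ {X Y : C} {ι : Type v} (f f' : ι → (X ⟶ Y)),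
    (∀ i, rel (f i) (f' i)) → rel (⨆ i, f i) (⨆ i, f' i)

namespace Congruence

variable {C : Type u} [Category.{v} C] [Quantaloid C] (r : Congruence C)

/-- The equivalence relation on one hom-set. -/
def setoid (X Y : C) : Setoid (X ⟶ Y) := ⟨r.rel, r.equivalence X Y⟩

/-- The objects of the quotient quantaloid are the objects of `C`. -/
structure Quot (r : Congruence C) where
  as : C

/-- The arrows of the quotient quantaloid are the equivalence classes of arrows of `C`. -/
instance : Category.{v} r.Quot where
  Hom X Y := Quotient (r.setoid X.as Y.as)
  id X := Quotient.mk _ (𝟙 X.as)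
  comp {X Y Z} f g := Quotient.map₂ (sa := r.setoid X.as Y.as) (sb := r.setoid Y.as Z.as)
    (sc := r.setoid X.as Z.as) (fun f g => f ≫ g) (fun _ _ hf _ _ hg => r.comp hf hg) f g
  id_comp f := by
    induction f using Quotient.inductionOn
    exact congrArg (Quotient.mk _) (Category.id_comp _)
  comp_id f := by
    induction f using Quotient.inductionOn
    exact congrArg (Quotient.mk _) (Category.comp_id _)
  assoc f g h := by
    induction f using Quotient.inductionOn
    induction g using Quotient.inductionOn
    induction h using Quotient.inductionOn
    exact congrArg (Quotient.mk _) (Category.assoc _ _ _)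

/-- The class of an arrow. -/
def cls {X Y : r.Quot} (f : X.as ⟶ Y.as) : X ⟶ Y := Quotient.mk (r.setoid X.as Y.as) f

/-- The quotient functor. -/
def quotientFunctor : C ⥤ r.Quot where
  obj X := ⟨X⟩
  map f := r.cls (X := ⟨_⟩) (Y := ⟨_⟩) f
  map_id _ := rfl
  map_comp _ _ := rfl

variable {r} {X Y Z : r.Quot}

theorem cls_eq_iff {f g : X.as ⟶ Y.as} : r.cls f = (r.cls g : X ⟶ Y) ↔ r.rel f g :=
  ⟨fun h => Quotient.exact h, fun h => Quotient.sound (s := r.setoid X.as Y.as) h⟩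

theorem cls_surjective (p : X ⟶ Y) : ∃ f, r.cls f = p := Quotient.exists_rep p

theorem cls_comp (f : X.as ⟶ Y.as) (g : Y.as ⟶ Z.as) :
    r.cls f ≫ r.cls g = (r.cls (f ≫ g) : X ⟶ Z) := rfl

/-- The largest arrow in an equivalence class. -/
def largest (p : X ⟶ Y) : X.as ⟶ Y.as := sSup {f | r.cls f = p}

theorem le_largest (f : X.as ⟶ Y.as) : f ≤ largest (r.cls f : X ⟶ Y) := le_sSup rfl

theorem rel_sSup_image {X Y : C} (S : Set (X ⟶ Y)) (F : (X ⟶ Y) → (X ⟶ Y))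
    (h : ∀ f ∈ S, r.rel f (F f)) : r.rel (sSup S) (sSup (F '' S)) := by
  have := r.iSup (fun s : S => (s : X ⟶ Y)) (fun s : S => F s) fun s => h _ s.2
  rwa [← sSup_eq_iSup', ← sSup_image'] at this

theorem cls_largest (p : X ⟶ Y) : r.cls (largest p) = p := by
  obtain ⟨f, rfl⟩ := cls_surjective p
  have := rel_sSup_image (r := r) {g | r.cls g = (r.cls f : X ⟶ Y)} (fun _ => f)
    fun g hg => cls_eq_iff.mp hg
  have h : ((fun _ => f) '' {g | r.cls g = (r.cls f : X ⟶ Y)}) = {f} := by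
    ext k
    simp only [Set.mem_image, Set.mem_ofPred_eq, Set.mem_singleton_iff]
    exact ⟨fun ⟨_, _, e⟩ => e.symm, fun e => ⟨f, rfl, e.symm⟩⟩
  rw [h, sSup_singleton] at this
  exact cls_eq_iff.mpr this

theorem largest_injective : Function.Injective (largest : (X ⟶ Y) → (X.as ⟶ Y.as)) :=
  Function.LeftInverse.injective cls_largest

theorem largest_cls_le {f : X.as ⟶ Y.as} {p : X ⟶ Y} (h : f ≤ largest p) :
    largest (r.cls f : X ⟶ Y) ≤ largest p := by
  have h1 : r.rel (largest (r.cls f : X ⟶ Y) ⊔ largest p) (f ⊔ largest p) := by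
    have := r.iSup (ι := ULift Bool)
      (fun b => bif b.down then largest (r.cls f : X ⟶ Y) else largest p)
      (fun b => bif b.down then f else largest p) (by
        rintro ⟨_ | _⟩
        · exact (r.equivalence _ _).refl _
        · exact cls_eq_iff.mp (cls_largest _))
    have e : ∀ a b : X.as ⟶ Y.as, (⨆ i : ULift.{v} Bool, bif i.down then a else b) = a ⊔ b :=
      fun a b => (Equiv.ulift.iSup_comp (g := fun i : Bool => bif i then a else b)).trans
        (by rw [iSup_bool_eq, cond_true, cond_false])
    rwa [e, e] at this
  rw [sup_eq_right.mpr h] at h1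
  have h2 := cls_eq_iff.mpr h1
  rw [cls_largest] at h2
  calc largest (r.cls f : X ⟶ Y) ≤ largest (r.cls f : X ⟶ Y) ⊔ largest p := le_sup_left
    _ ≤ largest (r.cls (largest (r.cls f : X ⟶ Y) ⊔ largest p) : X ⟶ Y) := le_largest _
    _ = largest p := by rw [h2]

/-- The complete lattice of equivalence classes: classes are ordered through their largest
members, and the join of classes is the class of the join. -/
instance : CompleteLattice (X ⟶ Y) :=
  letI : PartialOrder (X ⟶ Y) := PartialOrder.lift largest largest_injective
  letI : SupSet (X ⟶ Y) := ⟨fun S => r.cls (sSup (largest '' S))⟩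
  completeLatticeOfSup _ fun S =>
    ⟨fun p hp => (le_sSup (Set.mem_image_of_mem largest hp)).trans
        (le_largest (sSup (largest '' S))),
      fun q hq => largest_cls_le (sSup_le (by rintro _ ⟨p, hp, rfl⟩; exact hq hp))⟩

theorem sSup_def (S : Set (X ⟶ Y)) : sSup S = r.cls (sSup (largest '' S)) := rfl

theorem cls_sSup (T : Set (X.as ⟶ Y.as)) :
    (r.cls (sSup T) : X ⟶ Y) = sSup ((fun f => r.cls f) '' T) := by
  rw [sSup_def, Set.image_image]
  exact cls_eq_iff.mpr (rel_sSup_image T _ fun f _ => cls_eq_iff.mp (cls_largest _).symm)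

/-- The quotient quantaloid. -/
instance : Quantaloid r.Quot where
  homLattice _ _ := inferInstance
  sSup_comp S g := by
    obtain ⟨g, rfl⟩ := cls_surjective g
    rw [sSup_def, cls_comp, sSup_comp, cls_sSup, Set.image_image, Set.image_image]
    congr 1
    refine Set.image_congr fun p _ => ?_
    rw [← cls_comp, cls_largest]
  comp_sSup f S := by
    obtain ⟨f, rfl⟩ := cls_surjective f
    rw [sSup_def, cls_comp, comp_sSup, cls_sSup, Set.image_image, Set.image_image]
    congr 1
    refine Set.image_congr fun p _ => ?_
    rw [← cls_comp, cls_largest]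

end Congruence

/-! ### Chu connections and back diagonals in a quantaloid -/

/-- The objects of the quantaloid of Chu connections in `C` are the arrows of `C`. -/
structure ChuCon (C : Type u) [Category.{v} C] where
  {dom cod : C}
  hom : dom ⟶ cod

/-- A Chu connection from `f` to `g` is a pair of arrows `(u, v)` with `f ↙ u = v ↘ g`. -/
@[ext] structure ChuConHom {C : Type u} [Category.{v} C] [Quantaloid C] (f g : ChuCon C) where
  left : f.dom ⟶ g.dom
  right : f.cod ⟶ g.cod
  eq : lda f.hom left = rda right g.hom

namespace ChuCon

variable {C : Type u} [Category.{v} C] [Quantaloid C]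

instance : Category.{v} (ChuCon C) where
  Hom f g := ChuConHom f g
  id f := ⟨𝟙 _, 𝟙 _, eq_of_forall_le_iff fun k => by
    simp only [le_rda, le_lda, Category.id_comp, Category.comp_id]⟩
  comp p q := ⟨p.left ≫ q.left, p.right ≫ q.right, by
    rw [lda_comp, p.eq, lda_rda, q.eq, rda_comp]⟩
  id_comp _ := ChuConHom.ext (Category.id_comp _) (Category.id_comp _)
  comp_id _ := ChuConHom.ext (Category.comp_id _) (Category.comp_id _)
  assoc _ _ _ := ChuConHom.ext (Category.assoc _ _ _) (Category.assoc _ _ _)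

variable {f g h : ChuCon C}

@[ext] theorem hom_ext {p q : f ⟶ g} (h1 : p.left = q.left) (h2 : p.right = q.right) : p = q :=
  ChuConHom.ext h1 h2

/-- The componentwise order and joins of Chu connections. -/
instance : CompleteLattice (f ⟶ g) :=
  letI : PartialOrder (f ⟶ g) := PartialOrder.lift
    (fun p : f ⟶ g => (p.left, p.right)) fun _ _ h =>
      hom_ext (congrArg Prod.fst h) (congrArg Prod.snd h)
  letI : SupSet (f ⟶ g) := ⟨fun S =>
    ⟨sSup ((fun p => p.left) '' S), sSup ((fun p => p.right) '' S),
      eq_of_forall_le_iff fun k => by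
        rw [le_lda, le_rda, sSup_comp, comp_sSup]
        simp only [sSup_le_iff, Set.forall_mem_image]
        refine forall₂_congr fun p _ => ?_
        rw [← le_lda, p.eq, le_rda]⟩⟩
  completeLatticeOfSup _ fun S =>
    ⟨fun p hp => show _ ∧ _ from ⟨le_sSup ⟨p, hp, rfl⟩, le_sSup ⟨p, hp, rfl⟩⟩,
      fun q hq => show _ ∧ _ from ⟨sSup_le (by rintro _ ⟨p, hp, rfl⟩; exact (hq hp).1),
        sSup_le (by rintro _ ⟨p, hp, rfl⟩; exact (hq hp).2)⟩⟩

theorem sSup_left (S : Set (f ⟶ g)) : (sSup S).left = sSup ((fun p => p.left) '' S) := rfl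

theorem sSup_right (S : Set (f ⟶ g)) : (sSup S).right = sSup ((fun p => p.right) '' S) := rfl

/-- The quantaloid of Chu connections in `C`. -/
instance : Quantaloid (ChuCon C) where
  homLattice _ _ := inferInstance
  sSup_comp S q := by
    refine hom_ext ?_ ?_
    · change sSup _ ≫ q.left = sSup _
      rw [sSup_comp, Set.image_image, Set.image_image]; rfl
    · change sSup _ ≫ q.right = sSup _
      rw [sSup_comp, Set.image_image, Set.image_image]; rfl
  comp_sSup p S := by
    refine hom_ext ?_ ?_
    · change p.left ≫ sSup _ = sSup _
      rw [comp_sSup, Set.image_image, Set.image_image]; rfl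
    · change p.right ≫ sSup _ = sSup _
      rw [comp_sSup, Set.image_image, Set.image_image]; rfl

end ChuCon

/-- Two Chu connections `(u, v)` and `(u', v')` from `f` to `g` are identified when they have the
same back diagonal, `f ↙ u = f ↙ u'`. -/
def backDiagonalCongruence (C : Type u) [Category.{v} C] [Quantaloid C] :
    Congruence (ChuCon C) where
  rel {f g} p q := lda f.hom p.left = lda f.hom q.left
  equivalence f g := ⟨fun _ => rfl, fun h => h.symm, fun h h' => h.trans h'⟩
  comp {f g h p p' q q'} hp hq := by
    change lda f.hom (p.left ≫ q.left) = lda f.hom (p'.left ≫ q'.left)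
    rw [lda_comp, lda_comp, hp, p'.eq, lda_rda, lda_rda, hq]
  iSup {f g ι} p p' hp := eq_of_forall_le_iff fun k => by
    rw [le_lda, le_lda, iSup, iSup, ChuCon.sSup_left, ChuCon.sSup_left, sSup_comp, sSup_comp]
    simp only [sSup_le_iff, Set.forall_mem_image, Set.forall_mem_range]
    refine forall_congr' fun i => ?_
    rw [← le_lda, hp i, le_lda]

/-- The quantaloid of back diagonals in `C`: the quotient of `ChuCon C`. -/
abbrev BackDiag (C : Type u) [Category.{v} C] [Quantaloid C] := (backDiagonalCongruence C).Quot

/-- The quotient homomorphism from Chu connections to back diagonals. -/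
abbrev toBackDiag (C : Type u) [Category.{v} C] [Quantaloid C] : ChuCon C ⥤ BackDiag C :=
  (backDiagonalCongruence C).quotientFunctor

end Quantaloid

open Quantaloid

/-! ### Categories and distributors enriched in a small quantaloid -/

/-- A (small) `Q`-category. The set of objects with its type map to the objects of `Q` is
encoded by its fibres: `obj X` is the set of objects of type `X`. -/
structure QCategory (Q : Type u) [SmallCategory Q] [Quantaloid Q] where
  obj : Q → Type u
  hom : ∀ {X Y : Q}, obj X → obj Y → (X ⟶ Y)
  id_le : ∀ {X : Q} (x : obj X), 𝟙 X ≤ hom x x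
  comp_le : ∀ {X Y Z : Q} (x : obj X) (y : obj Y) (z : obj Z), hom x y ≫ hom y z ≤ hom x z

/-- A `Q`-distributor from `A` to `B`. -/
@[ext] structure QDistributor {Q : Type u} [SmallCategory Q] [Quantaloid Q]
    (A B : QCategory Q) where
  val : ∀ {X Y : Q}, A.obj X → B.obj Y → (X ⟶ Y)
  act : ∀ {X X' Y Y' : Q} (x : A.obj X) (x' : A.obj X') (y : B.obj Y) (y' : B.obj Y'),
    A.hom x' x ≫ val x y ≫ B.hom y y' ≤ val x' y'

/-- The objects of the quantaloid of `Q`-distributors are the `Q`-categories. The only arrows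
that the category structure below puts on this type are the distributors. -/
abbrev QDist (Q : Type u) [SmallCategory Q] [Quantaloid Q] := QCategory Q

namespace QDist

variable {Q : Type u} [SmallCategory Q] [Quantaloid Q]

theorem act_left {A B : QCategory Q} (φ : QDistributor A B) {X X' Y : Q}
    (x : A.obj X) (x' : A.obj X') (y : B.obj Y) : A.hom x' x ≫ φ.val x y ≤ φ.val x' y := by
  refine le_trans ?_ (φ.act x x' y y)
  refine comp_mono le_rfl ?_
  simpa using comp_mono (le_refl (φ.val x y)) (B.id_le y)

theorem act_right {A B : QCategory Q} (φ : QDistributor A B) {X Y Y' : Q}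
    (x : A.obj X) (y : B.obj Y) (y' : B.obj Y') : φ.val x y ≫ B.hom y y' ≤ φ.val x y' := by
  refine le_trans ?_ (φ.act x x y y')
  simpa using comp_mono (A.id_le x) (le_refl (φ.val x y ≫ B.hom y y'))

/-- Composition of distributors: `(ψ ∘ φ)(x, z) = ⋁ y, ψ(y, z) ∘ φ(x, y)`, where `y` ranges
over all objects of all types. -/
def comp {A B C : QCategory Q} (φ : QDistributor A B) (ψ : QDistributor B C) :
    QDistributor A C where
  val x z := ⨆ (Y : Q) (y : B.obj Y), φ.val x y ≫ ψ.val y z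
  act x x' z z' := by
    simp only [comp_iSup, iSup_comp]
    refine iSup₂_le fun Y y => le_trans ?_ (le_iSup₂ (f := fun (Y : Q) (y : B.obj Y) =>
      φ.val x' y ≫ ψ.val y z') Y y)
    rw [Category.assoc, ← Category.assoc]
    exact comp_mono (act_left φ x x' y) (act_right ψ y z z')

/-- The identity distributor on `A` is given by the hom-arrows of `A`. -/
def id (A : QCategory Q) : QDistributor A A where
  val x y := A.hom x y
  act x x' y y' := (comp_mono le_rfl (A.comp_le x y y')).trans (A.comp_le x' x y')

instance : Category.{u} (QDist Q) where
  Hom A B := QDistributor A B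
  id A := id A
  comp φ ψ := comp φ ψ
  id_comp {A B} φ := by
    refine QDistributor.ext ?_
    funext X Y x y
    refine le_antisymm (iSup₂_le fun Z z => act_left φ z x y) ?_
    refine le_trans ?_ (le_iSup₂ (f := fun (Z : Q) (z : A.obj Z) => A.hom x z ≫ φ.val z y) X x)
    simpa using comp_mono (A.id_le x) (le_refl (φ.val x y))
  comp_id {A B} φ := by
    refine QDistributor.ext ?_
    funext X Y x y
    refine le_antisymm (iSup₂_le fun Z z => act_right φ x z y) ?_
    refine le_trans ?_ (le_iSup₂ (f := fun (Z : Q) (z : B.obj Z) => φ.val x z ≫ B.hom z y) Y y)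
    simpa using comp_mono (le_refl (φ.val x y)) (B.id_le y)
  assoc {A B C D} φ ψ ξ := by
    refine QDistributor.ext ?_
    funext X Y x y
    change (⨆ (Z : Q) (z : C.obj Z), (⨆ (W : Q) (w : B.obj W), φ.val x w ≫ ψ.val w z) ≫ ξ.val z y)
      = ⨆ (W : Q) (w : B.obj W), φ.val x w ≫ (⨆ (Z : Q) (z : C.obj Z), ψ.val w z ≫ ξ.val z y)
    simp only [comp_iSup, iSup_comp, Category.assoc]
    refine le_antisymm ?_ ?_
    · refine iSup₂_le fun Z z => iSup₂_le fun W w => ?_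
      exact le_iSup₂_of_le W w (le_iSup₂_of_le Z z le_rfl)
    · refine iSup₂_le fun Z z => iSup₂_le fun W w => ?_
      exact le_iSup₂_of_le W w (le_iSup₂_of_le Z z le_rfl)

variable {A B C : QDist Q}

@[ext] theorem hom_ext {φ ψ : A ⟶ B}
    (h : ∀ {X Y : Q} (x : A.obj X) (y : B.obj Y), φ.val x y = ψ.val x y) : φ = ψ := by
  refine QDistributor.ext ?_
  funext X Y x y
  exact h x y

theorem comp_val (φ : A ⟶ B) (ψ : B ⟶ C) {X Z : Q} (x : A.obj X) (z : C.obj Z) :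
    (φ ≫ ψ).val x z = ⨆ (Y : Q) (y : B.obj Y), φ.val x y ≫ ψ.val y z := rfl

theorem id_val {X Y : Q} (x : A.obj X) (y : A.obj Y) :
    QDistributor.val (𝟙 A : A ⟶ A) x y = A.hom x y := rfl

/-- The pointwise order of distributors. -/
def Le (φ ψ : A ⟶ B) : Prop :=
  ∀ (X Y : Q) (x : A.obj X) (y : B.obj Y), φ.val x y ≤ ψ.val x y

/-- The complete lattice of distributors, with the pointwise order and pointwise joins. -/
instance : CompleteLattice (A ⟶ B) :=
  letI : PartialOrder (A ⟶ B) :=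
    { le := Le
      le_refl := fun _ _ _ _ _ => le_rfl
      le_trans := fun _ _ _ h h' _ _ x y => (h _ _ x y).trans (h' _ _ x y)
      le_antisymm := fun _ _ h h' => hom_ext fun x y => le_antisymm (h _ _ x y) (h' _ _ x y) }
  letI : SupSet (A ⟶ B) := ⟨fun S =>
    { val := fun x y => sSup ((fun φ => φ.val x y) '' S)
      act := fun x x' y y' => by
        rw [sSup_comp, comp_sSup]
        refine sSup_le ?_
        rintro _ ⟨_, ⟨_, ⟨φ, hφ, rfl⟩, rfl⟩, rfl⟩
        exact (φ.act x x' y y').trans (le_sSup ⟨φ, hφ, rfl⟩) }⟩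
  completeLatticeOfSup _ fun S =>
    ⟨fun φ hφ X Y x y =>
        (le_sSup ⟨φ, hφ, rfl⟩ : φ.val x y ≤ sSup ((fun φ => φ.val x y) '' S)),
      fun ψ hψ X Y x y => sSup_le (by rintro _ ⟨φ, hφ, rfl⟩; exact hψ hφ _ _ x y)⟩

theorem le_def {φ ψ : A ⟶ B} :
    φ ≤ ψ ↔ ∀ (X Y : Q) (x : A.obj X) (y : B.obj Y), φ.val x y ≤ ψ.val x y := Iff.rfl

theorem sSup_val (S : Set (A ⟶ B)) {X Y : Q} (x : A.obj X) (y : B.obj Y) :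
    (sSup S).val x y = sSup ((fun φ => φ.val x y) '' S) := rfl

/-- The quantaloid of `Q`-distributors. -/
instance : Quantaloid (QDist Q) where
  homLattice _ _ := inferInstance
  sSup_comp {A B C} S ψ := by
    refine hom_ext fun x z => ?_
    rw [comp_val, sSup_val, Set.image_image]
    simp only [comp_val, sSup_val, sSup_image, iSup_comp]
    exact le_antisymm
      (iSup₂_le fun Y y => iSup₂_le fun φ hφ => le_iSup₂_of_le φ hφ (le_iSup₂_of_le Y y le_rfl))
      (iSup₂_le fun φ hφ => iSup₂_le fun Y y => le_iSup₂_of_le Y y (le_iSup₂_of_le φ hφ le_rfl))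
  comp_sSup {A B C} φ S := by
    refine hom_ext fun x z => ?_
    rw [comp_val, sSup_val, Set.image_image]
    simp only [comp_val, sSup_val, sSup_image, comp_iSup]
    exact le_antisymm
      (iSup₂_le fun Y y => iSup₂_le fun φ hφ => le_iSup₂_of_le φ hφ (le_iSup₂_of_le Y y le_rfl))
      (iSup₂_le fun φ hφ => iSup₂_le fun Y y => le_iSup₂_of_le Y y (le_iSup₂_of_le φ hφ le_rfl))

end QDist

/-! ### `Q`-functors, presheaves, completeness -/

/-- A `Q`-functor: a type-preserving map on objects with `A(x, y) ≤ B(Fx, Fy)`. -/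
@[ext] structure QFunctor {Q : Type u} [SmallCategory Q] [Quantaloid Q]
    (A B : QCategory Q) where
  map : ∀ {X : Q}, A.obj X → B.obj X
  hom_le : ∀ {X Y : Q} (x : A.obj X) (y : A.obj Y), A.hom x y ≤ B.hom (map x) (map y)

section QCat

variable {Q : Type u} [SmallCategory Q] [Quantaloid Q]

namespace QCategory

/-- The underlying preorder on the objects of a given type. -/
def Le (A : QCategory Q) {X : Q} (x y : A.obj X) : Prop := 𝟙 X ≤ A.hom x y

/-- `A` is skeletal if its underlying preorder is antisymmetric. -/
def IsSkeletal (A : QCategory Q) : Prop :=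
  ∀ {X : Q} (x y : A.obj X), A.Le x y → A.Le y x → x = y

theorem Le.refl {A : QCategory Q} {X : Q} (x : A.obj X) : A.Le x x := A.id_le x

theorem Le.hom_le_left {A : QCategory Q} {X Y : Q} {x x' : A.obj X} (h : A.Le x x')
    (y : A.obj Y) : A.hom x' y ≤ A.hom x y := by
  refine le_trans ?_ (A.comp_le x x' y)
  simpa using comp_mono h (le_refl (A.hom x' y))

theorem Le.hom_le_right {A : QCategory Q} {X Y : Q} {y y' : A.obj Y} (h : A.Le y y')
    (x : A.obj X) : A.hom x y ≤ A.hom x y' := by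
  refine le_trans ?_ (A.comp_le x y y')
  simpa using comp_mono (le_refl (A.hom x y)) h

theorem Le.trans {A : QCategory Q} {X : Q} {x y z : A.obj X} (h : A.Le x y) (h' : A.Le y z) :
    A.Le x z := le_trans h' (h.hom_le_left z)

end QCategory

namespace QFunctor

variable {A B C : QCategory Q}

/-- The identity `Q`-functor. -/
def id (A : QCategory Q) : QFunctor A A := ⟨fun x => x, fun _ _ => le_rfl⟩

/-- The composite of `F` followed by `G`. -/
def comp (F : QFunctor A B) (G : QFunctor B C) : QFunctor A C :=
  ⟨fun x => G.map (F.map x), fun x y => (F.hom_le x y).trans (G.hom_le _ _)⟩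

/-- `F` is left adjoint to `G` for the pointwise order of `Q`-functors: `1 ≤ GF` and `FG ≤ 1`. -/
def Adj (F : QFunctor A B) (G : QFunctor B A) : Prop :=
  (∀ {X : Q} (x : A.obj X), A.Le x (G.map (F.map x))) ∧
    ∀ {X : Q} (y : B.obj X), B.Le (F.map (G.map y)) y

/-- `F` is a left adjoint `Q`-functor. -/
def IsLeftAdj (F : QFunctor A B) : Prop := ∃ G : QFunctor B A, F.Adj G

theorem map_Le (F : QFunctor A B) {X : Q} {x y : A.obj X} (h : A.Le x y) :
    B.Le (F.map x) (F.map y) := le_trans h (F.hom_le x y)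

theorem Adj.hom_eq {F : QFunctor A B} {G : QFunctor B A} (h : F.Adj G) {X Y : Q}
    (x : A.obj X) (y : B.obj Y) : B.hom (F.map x) y = A.hom x (G.map y) :=
  le_antisymm ((G.hom_le _ _).trans ((h.1 x).hom_le_left _))
    ((F.hom_le _ _).trans ((h.2 y).hom_le_right _))

theorem IsLeftAdj.comp {F : QFunctor A B} {G : QFunctor B C} (hF : F.IsLeftAdj)
    (hG : G.IsLeftAdj) : (F.comp G).IsLeftAdj := by
  obtain ⟨F', hF⟩ := hF
  obtain ⟨G', hG⟩ := hG
  exact ⟨G'.comp F', fun x => (hF.1 x).trans (F'.map_Le (hG.1 _)),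
    fun z => (G.map_Le (hF.2 _)).trans (hG.2 z)⟩

end QFunctor

/-- The single object of the `Q`-category `*_X`; it has type `X`. -/
inductive StarObj (X : Q) : Q → Type u
  | pt : StarObj X X

/-- The `Q`-category `*_X` with only one object, of type `X`, and hom-arrow `1_X`. -/
abbrev starQ (X : Q) : QCategory Q where
  obj := StarObj X
  hom a b := match a, b with
    | .pt, .pt => 𝟙 X
  id_le a := by cases a; exact le_rfl
  comp_le a b c := by cases a; cases b; cases c; simp

/-- The only entry of a distributor between one-object categories. -/
def entry {X Y : Q} (φ : starQ X ⟶ (starQ Y : QDist Q)) : X ⟶ Y := φ.val StarObj.pt StarObj.pt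

/-- An arrow of `Q` as a distributor between one-object categories. -/
def ofArrow {X Y : Q} (f : X ⟶ Y) : starQ X ⟶ (starQ Y : QDist Q) where
  val a b := match a, b with
    | .pt, .pt => f
  act a a' b b' := by cases a; cases a'; cases b; cases b'; simp

theorem le_entry {X Y : Q} {f : X ⟶ Y} {φ : starQ X ⟶ (starQ Y : QDist Q)} :
    f ≤ entry φ ↔ ofArrow f ≤ φ :=
  ⟨fun h _ _ a b => by cases a; cases b; exact h, fun h => h _ _ StarObj.pt StarObj.pt⟩

theorem ofArrow_comp {X Y Z : Q} (f : X ⟶ Y) (g : Y ⟶ Z) :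
    ofArrow (f ≫ g) = ofArrow f ≫ ofArrow g := by
  refine QDist.hom_ext fun a b => ?_
  cases a; cases b
  rw [QDist.comp_val]
  refine le_antisymm (le_iSup₂_of_le Y StarObj.pt le_rfl) (iSup₂_le fun W w => ?_)
  cases w; exact le_rfl

theorem ofArrow_id (X : Q) : ofArrow (𝟙 X) = 𝟙 (starQ X : QDist Q) := by
  refine QDist.hom_ext fun a b => ?_
  cases a; cases b; rfl

/-- The `Q`-category `PA` of presheaves on `A`: a presheaf of type `X` is a distributor from `A`
to `*_X`, and `PA(μ, μ') = μ' ↙ μ`. -/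
abbrev presheaf (A : QDist Q) : QCategory Q where
  obj X := A ⟶ starQ X
  hom μ μ' := entry (lda μ' μ)
  id_le {X} μ := by
    rw [le_entry, le_lda, ofArrow_id, Category.comp_id]
  comp_le μ μ' μ'' := by
    have h : ∀ {X Y : Q} (μ : A ⟶ starQ X) (ν : A ⟶ starQ Y),
        μ ≫ ofArrow (entry (lda ν μ)) ≤ ν := fun μ ν => le_lda.mp (le_entry.mp le_rfl)
    rw [le_entry, le_lda, ofArrow_comp, ← Category.assoc]
    exact (comp_mono (h μ μ') le_rfl).trans (h μ' μ'')

theorem le_presheaf_hom {A : QDist Q} {X Y : Q} {μ : A ⟶ starQ X} {ν : A ⟶ starQ Y} {f : X ⟶ Y} :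
    f ≤ (presheaf A).hom μ ν ↔ μ ≫ ofArrow f ≤ ν := by
  rw [← le_lda, ← le_entry]

theorem presheaf_Le {A : QDist Q} {X : Q} {μ ν : A ⟶ starQ X} :
    (presheaf A).Le μ ν ↔ μ ≤ ν := by
  change 𝟙 X ≤ (presheaf A).hom μ ν ↔ μ ≤ ν
  rw [le_presheaf_hom, ofArrow_id, Category.comp_id]

theorem comp_ofArrow_val {A : QDist Q} {X Y Z : Q} (μ : A ⟶ starQ X) (f : X ⟶ Y) (a : A.obj Z) :
    (μ ≫ ofArrow f).val a StarObj.pt = μ.val a StarObj.pt ≫ f := by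
  rw [QDist.comp_val]
  refine le_antisymm (iSup₂_le fun W w => ?_) (le_iSup₂_of_le X StarObj.pt le_rfl)
  cases w; exact le_rfl

theorem comp_ofArrow_le {A : QDist Q} {X Y : Q} {μ : A ⟶ starQ X} {ν : A ⟶ starQ Y} {f : X ⟶ Y} :
    μ ≫ ofArrow f ≤ ν ↔
      ∀ {Z : Q} (a : A.obj Z), μ.val a StarObj.pt ≫ f ≤ ν.val a StarObj.pt := by
  constructor
  · intro h Z a
    rw [← comp_ofArrow_val]
    exact h _ _ a StarObj.pt
  · intro h Z W a b
    cases b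
    rw [comp_ofArrow_val]
    exact h a

/-- The Yoneda embedding `x ↦ A(-, x)`. -/
def yonedaQ (A : QDist Q) : QFunctor A (presheaf A) where
  map x :=
    { val := fun a b => match b with
        | .pt => A.hom a x
      act := fun a a' b b' => by
        cases b; cases b'
        simpa [starQ] using A.comp_le a' a x }
  hom_le x y := by
    rw [le_presheaf_hom, comp_ofArrow_le]
    exact fun a => A.comp_le a x y

/-- `A` is complete if the Yoneda embedding has a left adjoint. -/
def QCategory.IsComplete (A : QCategory Q) : Prop :=
  ∃ sup : QFunctor (presheaf A) A, sup.Adj (yonedaQ A)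

theorem yonedaQ_val {A : QDist Q} {X Y : Q} (x : A.obj X) (a : A.obj Y) :
    QDistributor.val ((yonedaQ A).map x : A ⟶ starQ X) a StarObj.pt = A.hom a x := rfl

end QCat

/-! ### The quantaloid of skeletal complete `Q`-categories -/

/-- The objects of `QCCat Q` are the skeletal complete `Q`-categories. -/
structure QCCat (Q : Type u) [SmallCategory Q] [Quantaloid Q] where
  cat : QCategory Q
  skeletal : cat.IsSkeletal
  complete : cat.IsComplete

namespace QCCat

variable {Q : Type u} [SmallCategory Q] [Quantaloid Q]

/-- The arrows of `QCCat Q` are the left adjoint `Q`-functors. -/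
instance : Category.{u} (QCCat Q) where
  Hom A B := {F : QFunctor A.cat B.cat // F.IsLeftAdj}
  id A := ⟨QFunctor.id _, QFunctor.id _, fun x => A.cat.id_le x, fun x => A.cat.id_le x⟩
  comp F G := ⟨F.1.comp G.1, F.2.comp G.2⟩

variable {A B C : QCCat Q}

@[ext] theorem hom_ext {F G : A ⟶ B}
    (h : ∀ {X : Q} (x : A.cat.obj X), F.1.map x = G.1.map x) : F = G := by
  refine Subtype.ext (QFunctor.ext ?_)
  funext X x
  exact h x

theorem comp_map (F : A ⟶ B) (G : B ⟶ C) {X : Q} (x : A.cat.obj X) :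
    (F ≫ G).1.map x = G.1.map (F.1.map x) := rfl

/-- The pointwise order of `Q`-functors. -/
def Le (F G : A ⟶ B) : Prop :=
  ∀ (X : Q) (x : A.cat.obj X), B.cat.Le (F.1.map x) (G.1.map x)

instance : PartialOrder (A ⟶ B) where
  le := Le
  le_refl F X x := B.cat.id_le _
  le_trans F G H h h' X x := (h X x).trans (h' X x)
  le_antisymm F G h h' := hom_ext fun x => B.skeletal _ _ (h _ x) (h' _ x)

theorem le_def {F G : A ⟶ B} :
    F ≤ G ↔ ∀ (X : Q) (x : A.cat.obj X), B.cat.Le (F.1.map x) (G.1.map x) := Iff.rfl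

/-- Pointwise joins of left adjoint `Q`-functors exist and are left adjoint. -/
theorem exists_pointwise_join (S : Set (A ⟶ B)) :
    ∃ H : A ⟶ B, ∀ {X Y : Q} (x : A.cat.obj X) (b : B.cat.obj Y),
      B.cat.hom (H.1.map x) b = ⨅ F ∈ S, B.cat.hom (F.1.map x) b := by
  obtain ⟨supA, hA⟩ := A.complete
  obtain ⟨supB, hB⟩ := B.complete
  let μ : ∀ {X : Q}, A.cat.obj X → ((B.cat : QDist Q) ⟶ starQ X) := fun x =>
    sSup ((fun F : A ⟶ B => (yonedaQ B.cat).map (F.1.map x)) '' S)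
  have key : ∀ {X Y : Q} (x : A.cat.obj X) (b : B.cat.obj Y),
      B.cat.hom (supB.map (μ x)) b = ⨅ F ∈ S, B.cat.hom (F.1.map x) b := by
    intro X Y x b
    rw [hB.hom_eq]
    refine eq_of_forall_le_iff fun k => ?_
    rw [le_presheaf_hom]
    simp only [μ, le_iInf_iff]
    rw [sSup_comp]
    simp only [sSup_le_iff, Set.forall_mem_image]
    refine forall₂_congr fun F _ => ?_
    rw [comp_ofArrow_le]
    constructor
    · intro h
      have := (comp_mono (B.cat.id_le (F.1.map x)) (le_refl k)).trans (h (F.1.map x))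
      rwa [Category.id_comp] at this
    · intro h Z a
      exact (comp_mono (le_refl (B.cat.hom a (F.1.map x))) h).trans (B.cat.comp_le _ _ _)
  let H : QFunctor A.cat B.cat :=
    { map := fun x => supB.map (μ x)
      hom_le := fun x y => by
        rw [key]
        refine le_iInf₂ fun F hF => (F.1.hom_le x y).trans (QCategory.Le.hom_le_right ?_ _)
        have h := (key y (supB.map (μ y))).symm ▸ B.cat.id_le (supB.map (μ y))
        exact h.trans (iInf₂_le F hF) }
  have keyH : ∀ {X Y : Q} (x : A.cat.obj X) (b : B.cat.obj Y),
      B.cat.hom (H.map x) b = ⨅ F ∈ S, B.cat.hom (F.1.map x) b := key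
  let ν : ∀ {Y : Q}, B.cat.obj Y → ((A.cat : QDist Q) ⟶ starQ Y) := fun {Y} y =>
    { val := fun a b => match b with
        | .pt => B.cat.hom (H.map a) y
      act := fun a a' b b' => by
        cases b; cases b'
        have := (comp_mono (H.hom_le a' a) (le_refl (B.cat.hom (H.map a) y))).trans
          (B.cat.comp_le _ _ _)
        simpa [starQ] using this }
  let G : QFunctor B.cat A.cat :=
    { map := fun y => supA.map (ν y)
      hom_le := fun x y => by
        refine le_trans ?_ (supA.hom_le _ _)
        rw [le_presheaf_hom, comp_ofArrow_le]
        exact fun a => B.cat.comp_le _ _ _ }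
  refine ⟨⟨H, G, fun x => ?_, fun y => ?_⟩, key⟩
  · have h1 : (presheaf (A.cat : QDist Q)).Le (ν (H.map x)) ((yonedaQ A.cat).map (G.map (H.map x))) :=
      hA.1 _
    have h2 := presheaf_Le.mp h1 _ _ x StarObj.pt
    exact (B.cat.id_le (H.map x)).trans h2
  · change 𝟙 _ ≤ B.cat.hom _ y
    rw [keyH]
    refine le_iInf₂ fun F hF => ?_
    obtain ⟨R, hR⟩ := F.2
    change 𝟙 _ ≤ B.cat.hom (F.1.map (supA.map (ν y))) y
    rw [hR.hom_eq, hA.hom_eq]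
    refine presheaf_Le.mpr ?_
    intro Z W a b
    cases b
    change B.cat.hom (H.map a) y ≤ A.cat.hom a (R.map y)
    rw [keyH, ← hR.hom_eq]
    exact iInf₂_le F hF

/-- The pointwise join. -/
noncomputable instance : SupSet (A ⟶ B) := ⟨fun S => (exists_pointwise_join S).choose⟩

theorem sSup_hom (S : Set (A ⟶ B)) {X Y : Q} (x : A.cat.obj X) (b : B.cat.obj Y) :
    B.cat.hom ((sSup S).1.map x) b = ⨅ F ∈ S, B.cat.hom (F.1.map x) b :=
  (exists_pointwise_join S).choose_spec x b

/-- The complete lattice of left adjoint `Q`-functors, for the pointwise order. -/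
noncomputable instance : CompleteLattice (A ⟶ B) :=
  completeLatticeOfSup _ fun S =>
    ⟨fun F hF X x => by
      have h := (sSup_hom S x ((sSup S).1.map x)) ▸ B.cat.id_le ((sSup S).1.map x)
      exact h.trans (iInf₂_le F hF),
    fun G hG X x => by
      change 𝟙 X ≤ _
      rw [sSup_hom]
      exact le_iInf₂ fun F hF => hG hF _ x⟩

theorem eq_of_hom_eq {X : Q} {x y : B.cat.obj X}
    (h : ∀ {Y : Q} (b : B.cat.obj Y), B.cat.hom x b = B.cat.hom y b) : x = y :=
  B.skeletal _ _ (by rw [QCategory.Le, h]; exact B.cat.id_le y)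
    (by rw [QCategory.Le, ← h]; exact B.cat.id_le x)

/-- The quantaloid of skeletal complete `Q`-categories and left adjoint `Q`-functors. -/
noncomputable instance : Quantaloid (QCCat Q) where
  homLattice _ _ := inferInstance
  sSup_comp {A B C} S G := by
    refine hom_ext fun x => eq_of_hom_eq fun c => ?_
    obtain ⟨R, hR⟩ := G.2
    rw [comp_map, hR.hom_eq, sSup_hom, sSup_hom, iInf_image]
    refine iInf_congr fun F => iInf_congr fun _ => ?_
    rw [comp_map, hR.hom_eq]
  comp_sSup {A B C} F S := by
    refine hom_ext fun x => eq_of_hom_eq fun c => ?_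
    rw [comp_map, sSup_hom, sSup_hom, iInf_image]
    rfl

end QCCat

/-! ### The functor `M` from Chu connections to skeletal complete `Q`-categories -/

section MFunctor

variable {Q : Type u} [SmallCategory Q] [Quantaloid Q]

/-- The Isbell closure `(φ ↙ μ) ↘ φ` of a presheaf `μ`: the value at `μ` of the monad on
presheaves induced by the Isbell adjunction `μ ↦ φ ↙ μ`, `λ ↦ λ ↘ φ`. -/
def isbell {A B : QDist Q} (φ : A ⟶ B) {X : Q} (μ : A ⟶ starQ X) : A ⟶ starQ X :=
  rda (lda φ μ) φ

theorem le_isbell {A B : QDist Q} (φ : A ⟶ B) {X : Q} (μ : A ⟶ starQ X) : μ ≤ isbell φ μ :=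
  le_rda.mpr (comp_lda_le _ _)

theorem isbell_mono {A B : QDist Q} (φ : A ⟶ B) {X : Q} {μ ν : A ⟶ starQ X} (h : μ ≤ ν) :
    isbell φ μ ≤ isbell φ ν :=
  le_rda.mpr ((comp_mono le_rfl (le_lda.mpr ((comp_mono h le_rfl).trans (comp_lda_le _ _)))).trans
    (rda_comp_le _ _))

theorem isbell_rda {A B : QDist Q} (φ : A ⟶ B) {X : Q} (κ : starQ X ⟶ B) :
    isbell φ (rda κ φ) = rda κ φ := by
  refine le_antisymm (le_rda.mpr ?_) (le_isbell _ _)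
  exact (comp_mono le_rfl (le_lda.mpr (rda_comp_le _ _))).trans (rda_comp_le _ _)

theorem isbell_isbell {A B : QDist Q} (φ : A ⟶ B) {X : Q} (μ : A ⟶ starQ X) :
    isbell φ (isbell φ μ) = isbell φ μ := isbell_rda _ _

theorem isbell_comp_le {A B : QDist Q} (φ : A ⟶ B) {X Y : Q} (μ : A ⟶ starQ X)
    (k : (starQ X : QDist Q) ⟶ starQ Y) : isbell φ μ ≫ k ≤ isbell φ (μ ≫ k) := by
  rw [isbell, isbell, le_rda, Category.assoc]
  refine (comp_mono le_rfl (le_lda.mpr ?_)).trans (rda_comp_le _ _)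
  rw [← Category.assoc]
  exact comp_lda_le _ _

/-- `M φ`: the full subcategory of the presheaves on `A` that are fixed by the Isbell monad. -/
abbrev MCat {A B : QDist Q} (φ : A ⟶ B) : QCategory Q where
  obj X := {μ : A ⟶ starQ X // isbell φ μ = μ}
  hom μ ν := (presheaf A).hom μ.1 ν.1
  id_le μ := (presheaf A).id_le μ.1
  comp_le μ ν ξ := (presheaf A).comp_le μ.1 ν.1 ξ.1

theorem le_MCat_hom {A B : QDist Q} {φ : A ⟶ B} {X Y : Q} {μ : (MCat φ).obj X}
    {ν : (MCat φ).obj Y} {f : X ⟶ Y} : f ≤ (MCat φ).hom μ ν ↔ μ.1 ≫ ofArrow f ≤ ν.1 :=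
  le_presheaf_hom

theorem MCat_Le {A B : QDist Q} {φ : A ⟶ B} {X : Q} {μ ν : (MCat φ).obj X} :
    (MCat φ).Le μ ν ↔ μ.1 ≤ ν.1 := presheaf_Le

theorem MCat_isSkeletal {A B : QDist Q} (φ : A ⟶ B) : (MCat φ).IsSkeletal :=
  fun _ _ h h' => Subtype.ext (le_antisymm (MCat_Le.mp h) (MCat_Le.mp h'))

theorem MCat_isComplete {A B : QDist Q} (φ : A ⟶ B) : (MCat φ).IsComplete := by
  let J : A ⟶ (MCat φ : QDist Q) :=
    { val := fun a μ => μ.1.val a StarObj.pt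
      act := fun a a' μ μ' => by
        have h : μ.1.val a StarObj.pt ≫ (MCat φ).hom μ μ' ≤ μ'.1.val a StarObj.pt :=
          comp_ofArrow_le.mp (le_MCat_hom.mp le_rfl) a
        exact (comp_mono le_rfl h).trans (QDist.act_left μ'.1 a a' StarObj.pt) }
  refine ⟨⟨fun M => ⟨isbell φ (J ≫ M), isbell_isbell _ _⟩, fun M N => ?_⟩, fun {X} M => ?_,
    fun {X} μ => ?_⟩
  · rw [le_MCat_hom]
    refine (isbell_comp_le _ _ _).trans (isbell_mono _ ?_)
    rw [Category.assoc]
    exact comp_mono le_rfl (le_presheaf_hom.mp le_rfl)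
  · refine presheaf_Le.mpr ?_
    intro Z W μ b
    cases b
    refine le_MCat_hom.mpr (le_trans ?_ (le_isbell _ _))
    rw [comp_ofArrow_le]
    intro Z' a
    exact le_iSup₂ (f := fun (Y : Q) (y : (MCat φ).obj Y) => J.val a y ≫ M.val y StarObj.pt) Z μ
  · refine MCat_Le.mpr ?_
    refine (isbell_mono φ (?_ : _ ≤ μ.1)).trans μ.2.le
    intro Z W a b
    cases b
    refine iSup₂_le fun Y y => ?_
    exact comp_ofArrow_le.mp (le_MCat_hom.mp (le_refl ((MCat φ).hom y μ))) a

theorem comp_isbell_le {f g : ChuCon (QDist Q)} (p : f ⟶ g) {X : Q} (ν : g.dom ⟶ starQ X) :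
    p.left ≫ isbell g.hom ν ≤ isbell f.hom (p.left ≫ ν) := by
  rw [isbell, isbell, le_rda, Category.assoc, ← le_lda, p.eq, le_rda, Category.assoc]
  refine (comp_mono le_rfl (le_lda.mpr ?_)).trans (rda_comp_le _ _)
  rw [← Category.assoc, ← le_rda, ← p.eq, le_lda, ← Category.assoc]
  exact comp_lda_le _ _

/-- For a Chu connection `(ζ, η)` from `φ` to `ψ`, the `Q`-functor from `M ψ` to `M φ` that sends
a presheaf `μ` to the Isbell closure of `μ ∘ ζ`. -/
def MMap {f g : ChuCon (QDist Q)} (p : f ⟶ g) : QFunctor (MCat g.hom) (MCat f.hom) where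
  map μ := ⟨isbell f.hom (p.left ≫ μ.1), isbell_isbell _ _⟩
  hom_le μ ν := by
    rw [le_MCat_hom]
    refine (isbell_comp_le _ _ _).trans (isbell_mono _ ?_)
    rw [Category.assoc]
    exact comp_mono le_rfl (le_MCat_hom.mp le_rfl)

theorem MMap_isLeftAdj {f g : ChuCon (QDist Q)} (p : f ⟶ g) : (MMap p).IsLeftAdj := by
  refine ⟨⟨fun μ => ⟨lda μ.1 p.left, ?_⟩, fun μ ν => ?_⟩, fun μ => ?_, fun μ => ?_⟩
  · have h : lda μ.1 p.left = rda (lda f.hom μ.1 ≫ p.right) g.hom := by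
      conv_lhs => rw [← μ.2]
      rw [isbell, lda_rda, p.eq, rda_comp]
    rw [h, isbell_rda]
  · rw [le_MCat_hom, le_lda, ← Category.assoc]
    exact (comp_mono (comp_lda_le _ _) le_rfl).trans (le_MCat_hom.mp le_rfl)
  · exact MCat_Le.mpr (le_lda.mpr (le_isbell _ _))
  · exact MCat_Le.mpr ((isbell_mono _ (comp_lda_le _ _)).trans μ.2.le)

variable (Q) in
/-- The functor `M` from the opposite of the quantaloid of Chu connections between
`Q`-distributors to the quantaloid of skeletal complete `Q`-categories. -/
def MFunctor : (ChuCon (QDist Q))ᵒᵖ ⥤ QCCat Q where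
  obj f := ⟨MCat f.unop.hom, MCat_isSkeletal _, MCat_isComplete _⟩
  map p := ⟨MMap p.unop, MMap_isLeftAdj _⟩
  map_id f := QCCat.hom_ext fun μ => Subtype.ext (by
    change isbell f.unop.hom (𝟙 f.unop.dom ≫ μ.1) = μ.1
    rw [Category.id_comp]; exact μ.2)
  map_comp {f g h} p q := QCCat.hom_ext fun μ => Subtype.ext (by
    change isbell h.unop.hom ((q.unop.left ≫ p.unop.left) ≫ μ.1) =
      isbell h.unop.hom (q.unop.left ≫ isbell g.unop.hom (p.unop.left ≫ μ.1))
    rw [Category.assoc]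
    refine le_antisymm (isbell_mono _ (comp_mono le_rfl (le_isbell _ _))) ?_
    exact (isbell_mono _ (comp_isbell_le _ _)).trans (isbell_isbell _ _).le)

end MFunctor

/-!
# Back diagonals and complete `Q`-categories

The functor `M` on Chu connections factors through back diagonals and gives a dual equivalence with
skeletal complete `Q`-categories. The reasons are as follows.

* *Well defined and faithful on classes.* For a Chu connection `(ζ, η)` from `φ` to `ψ`, the presheaf
  `M(ζ, η)(μ) = (φ ↙ (μ ∘ ζ)) ↘ φ` depends only on `φ ↙ ζ`, because `φ ↙ (μ ∘ ζ) = (φ ↙ ζ) ↙ μ`.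
  Conversely `(φ ↙ ζ)(a, b)` is the hom-arrow in `M φ` from the value of `M(ζ, η)` at the closure of
  the representable at `a` to the column `φ(-, b)` (`lda_val_eq_MCat_hom`, `MMap_eq_iff`).
* *Full.* Let `G : M ψ → M φ` have the right adjoint `R`. Put `ζ(-, a) = G(cl A(-, a))`, where `cl`
  is the closure for `ψ`, and `η(b, -) = ψ ↙ R(φ(-, b))`. By the Yoneda lemma and adjunction both
  `φ ↙ ζ` and `η ↘ ψ` have the entry `R(φ(-, b))(a)` at `(a, b)`, and `M(ζ, η) = G` because both
  have the right adjoint `R` (`exists_MMap_eq`).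
* *Essentially surjective.* If `A` is complete, the presheaves that are closed for the identity
  distributor on `A` are the representables (`isbell_id`), so `M(1_A)` is a copy of `A` when `A` is
  skeletal (`nonempty_iso_MFunctor_id`).
* *Joins.* Joins of left adjoints are determined by hom-arrows out of their values, and
  `f ≤ M φ(M(ζ, η)(μ), ν)` means `f ∘ μ ∘ ζ ≤ ν`, which turns joins in `ζ` into conjunctions
  (`MFunctor_map_sSup`). An inverse of a join-preserving equivalence preserves joins
  (`isQuantaloidHom_inverse`).

The induced functor is unique since the quotient functor is bijective on objects and full.
-/

namespace Quantaloid

/-! ### Functors out of a quotient quantaloid -/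

namespace Congruence

variable {C : Type u} [Category.{v} C] [Quantaloid C] (r : Congruence C)
  {D : Type u'} [Category.{v'} D]

/-- A contravariant functor on `C` that identifies congruent arrows descends to the quotient. -/
def descOp (F : Cᵒᵖ ⥤ D)
    (h : ∀ {X Y : C} (f g : X ⟶ Y), r.rel f g → F.map f.op = F.map g.op) : r.Quotᵒᵖ ⥤ D where
  obj X := F.obj (op X.unop.as)
  map {X Y} p := Quotient.lift (s := r.setoid Y.unop.as X.unop.as)
    (fun f => F.map f.op) (fun f g => h f g) p.unop
  map_id X := F.map_id _
  map_comp {X Y Z} p q := by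
    obtain ⟨f, hf⟩ := cls_surjective p.unop
    obtain ⟨g, hg⟩ := cls_surjective q.unop
    obtain rfl : p = (r.cls f).op := Quiver.Hom.unop_inj hf.symm
    obtain rfl : q = (r.cls g).op := Quiver.Hom.unop_inj hg.symm
    exact F.map_comp f.op g.op

/-- Precomposition with the opposite of the quotient functor is injective, because the quotient
functor is bijective on objects and full. -/
theorem eq_of_quotientFunctor_op_comp_eq {F G : r.Quotᵒᵖ ⥤ D}
    (h : r.quotientFunctor.op ⋙ F = r.quotientFunctor.op ⋙ G) : F = G := by
  refine CategoryTheory.Functor.ext (fun X => Functor.congr_obj h (op X.unop.as))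
    fun X Y p => ?_
  obtain ⟨f, hf⟩ := cls_surjective p.unop
  obtain rfl : p = (r.cls f).op := Quiver.Hom.unop_inj hf.symm
  exact Functor.congr_hom h f.op

end Congruence

/-! ### Inverses of equivalences of quantaloids -/

/-- If one functor of an equivalence of categories preserves joins of arrows, then so does the
other. -/
theorem isQuantaloidHom_inverse {C : Type u} [Category.{v} C] [Quantaloid C]
    {D : Type u'} [Category.{v'} D] [Quantaloid D] (e : C ≌ D) (h : IsQuantaloidHom e.functor) :
    IsQuantaloidHom e.inverse := by
  intro X Y S
  refine e.functor.map_injective ?_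
  rw [h, e.fun_inv_map, sSup_comp, comp_sSup, Set.image_image, Set.image_image]
  simp only [e.fun_inv_map]
  rfl

end Quantaloid

section

variable {Q : Type u} [SmallCategory Q] [Quantaloid Q]

/-! ### Implications between distributors -/

namespace QDist

/-- The covariant representable `A(a, -)`, as a distributor from a one-object category. -/
def corep (A : QDist Q) {X : Q} (a : A.obj X) : (starQ X : QDist Q) ⟶ A where
  val b x := match b with
    | .pt => A.hom a x
  act b b' x x' := by
    cases b; cases b'
    simpa [starQ] using A.comp_le a x x'

/-- The column `φ(-, b)` of a distributor, a presheaf on its domain. -/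
def col {A B : QDist Q} (φ : A ⟶ B) {Y : Q} (b : B.obj Y) : A ⟶ starQ Y where
  val a c := match c with
    | .pt => φ.val a b
  act a a' c c' := by
    cases c; cases c'
    simpa [starQ] using act_left φ a a' b

theorem comp_le_iff {A B C : QDist Q} {φ : A ⟶ B} {ψ : B ⟶ C} {χ : A ⟶ C} :
    φ ≫ ψ ≤ χ ↔ ∀ {X Y Z : Q} (a : A.obj X) (b : B.obj Y) (c : C.obj Z),
      φ.val a b ≫ ψ.val b c ≤ χ.val a c := by
  refine ⟨fun h X Y Z a b c => ?_, fun h X Z a c => iSup₂_le fun Y b => h a b c⟩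
  exact (le_iSup₂ (f := fun (Y : Q) (y : B.obj Y) => φ.val a y ≫ ψ.val y c) Y b).trans
    (h X Z a c)

theorem le_lda_val {A B C : QDist Q} {φ : A ⟶ C} {ζ : A ⟶ B} {X Y : Q} {b : B.obj X} {c : C.obj Y}
    {f : X ⟶ Y} : f ≤ (lda φ ζ).val b c ↔
      ∀ {Z : Q} (a : A.obj Z), ζ.val a b ≫ f ≤ φ.val a c := by
  constructor
  · intro h Z a
    exact (comp_mono le_rfl h).trans (comp_le_iff.mp (comp_lda_le φ ζ) a b c)
  · intro h
    let κ : B ⟶ C :=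
      { val := fun x y => B.hom x b ≫ f ≫ C.hom c y
        act := fun x x' y y' => by
          simp only [Category.assoc]
          rw [← Category.assoc]
          exact comp_mono (B.comp_le _ _ _) (comp_mono le_rfl (C.comp_le _ _ _)) }
    have hκ : κ ≤ lda φ ζ := by
      rw [le_lda, comp_le_iff]
      intro X' Y' Z' a x y
      change ζ.val a x ≫ B.hom x b ≫ f ≫ C.hom c y ≤ _
      rw [← Category.assoc, ← Category.assoc]
      exact (comp_mono ((comp_mono (act_right ζ a x b) le_rfl).trans (h a)) le_rfl).trans
        (act_right φ a c y)
    refine le_trans ?_ (hκ _ _ b c)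
    change f ≤ B.hom b b ≫ f ≫ C.hom c c
    simpa using comp_mono (B.id_le b) (comp_mono (le_refl f) (C.id_le c))

theorem le_rda_val {A B C : QDist Q} {φ : A ⟶ C} {η : B ⟶ C} {X Y : Q} {a : A.obj X} {b : B.obj Y}
    {f : X ⟶ Y} : f ≤ (rda η φ).val a b ↔
      ∀ {Z : Q} (c : C.obj Z), f ≫ η.val b c ≤ φ.val a c := by
  constructor
  · intro h Z c
    exact (comp_mono h le_rfl).trans (comp_le_iff.mp (rda_comp_le η φ) a b c)
  · intro h
    let κ : A ⟶ B :=
      { val := fun x y => A.hom x a ≫ f ≫ B.hom b y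
        act := fun x x' y y' => by
          simp only [Category.assoc]
          rw [← Category.assoc]
          exact comp_mono (A.comp_le _ _ _) (comp_mono le_rfl (B.comp_le _ _ _)) }
    have hκ : κ ≤ rda η φ := by
      rw [le_rda, comp_le_iff]
      intro X' Y' Z' x y c
      change (A.hom x a ≫ f ≫ B.hom b y) ≫ η.val y c ≤ _
      simp only [Category.assoc]
      exact (comp_mono le_rfl ((comp_mono le_rfl (act_left η y b c)).trans (h c))).trans
        (act_left φ a x c)
    refine le_trans ?_ (hκ _ _ a b)
    change f ≤ A.hom a a ≫ f ≫ B.hom b b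
    simpa using comp_mono (A.id_le a) (comp_mono (le_refl f) (B.id_le b))

end QDist

open QDist

/-- The Yoneda lemma for presheaves. -/
theorem presheaf_hom_yonedaQ {A : QDist Q} {X Y : Q} (a : A.obj X) (μ : A ⟶ starQ Y) :
    (presheaf A).hom ((yonedaQ A).map a) μ = μ.val a StarObj.pt := by
  refine eq_of_forall_le_iff fun f => ?_
  rw [le_presheaf_hom, comp_ofArrow_le]
  constructor
  · intro h
    have h' : A.hom a a ≫ f ≤ μ.val a StarObj.pt := h a
    refine le_trans ?_ h'
    simpa using comp_mono (A.id_le a) (le_refl f)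
  · intro h Z x
    exact (comp_mono le_rfl h).trans (act_left μ a x StarObj.pt)

/-! ### The Isbell closure -/

theorem isbell_le_iff {A B : QDist Q} {φ : A ⟶ B} {X : Q} {μ ν : A ⟶ starQ X}
    (h : isbell φ ν = ν) : isbell φ μ ≤ ν ↔ μ ≤ ν :=
  ⟨(le_isbell φ μ).trans, fun hμ => (isbell_mono φ hμ).trans h.le⟩

/-- Homs out of the Isbell closure of `μ` into a closed presheaf are homs out of `μ`. -/
theorem presheaf_hom_isbell {A B : QDist Q} {φ : A ⟶ B} {X Y : Q} (μ : A ⟶ starQ X)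
    {ν : A ⟶ starQ Y} (h : isbell φ ν = ν) :
    (presheaf A).hom (isbell φ μ) ν = (presheaf A).hom μ ν := by
  refine eq_of_forall_le_iff fun f => ?_
  rw [le_presheaf_hom, le_presheaf_hom]
  refine ⟨(comp_mono (le_isbell φ μ) le_rfl).trans, fun hf => ?_⟩
  exact (isbell_comp_le _ _ _).trans ((isbell_le_iff h).mpr hf)

theorem isbell_col {A B : QDist Q} (φ : A ⟶ B) {Y : Q} (b : B.obj Y) :
    isbell φ (col φ b) = col φ b := by
  have h : col φ b = rda (corep B b) φ := by
    refine hom_ext fun a c => ?_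
    cases c
    refine eq_of_forall_le_iff fun f => ?_
    rw [le_rda_val]
    constructor
    · intro hf Z c
      exact (comp_mono hf le_rfl).trans (act_right φ a b c)
    · intro hf
      refine le_trans ?_ (hf b)
      change f ≤ f ≫ B.hom b b
      simpa using comp_mono (le_refl f) (B.id_le b)
  rw [h, isbell_rda]

/-- The Isbell closure of the representable presheaf at `a`, as an object of `M φ`. -/
def MCat.unit {A B : QDist Q} (φ : A ⟶ B) {X : Q} (a : A.obj X) : (MCat φ).obj X :=
  ⟨isbell φ ((yonedaQ A).map a), isbell_isbell _ _⟩

/-- The Yoneda lemma in `M φ`. -/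
theorem MCat.hom_unit {A B : QDist Q} {φ : A ⟶ B} {X Y : Q} (a : A.obj X) (μ : (MCat φ).obj Y) :
    (MCat φ).hom (MCat.unit φ a) μ = μ.1.val a StarObj.pt :=
  (presheaf_hom_isbell _ μ.2).trans (presheaf_hom_yonedaQ a μ.1)

/-- The column `φ(-, b)`, as an object of `M φ`. -/
def MCat.col {A B : QDist Q} (φ : A ⟶ B) {Y : Q} (b : B.obj Y) : (MCat φ).obj Y :=
  ⟨QDist.col φ b, isbell_col φ b⟩

/-! ### `M` identifies exactly the Chu connections with the same back diagonal -/

/-- The back diagonal `φ ↙ ζ` can be read off from `M(ζ, η)`, by evaluating that functor on the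
closures of representables and mapping into the columns of `φ`. -/
theorem lda_val_eq_MCat_hom {f g : ChuCon (QDist Q)} (p : f ⟶ g) {X Y : Q} (a : g.dom.obj X)
    (b : f.cod.obj Y) : (lda f.hom p.left).val a b =
      (MCat f.hom).hom ((MMap p).map (MCat.unit g.hom a)) (MCat.col f.hom b) := by
  refine eq_of_forall_le_iff fun k => ?_
  have h1 : p.left ≫ ((yonedaQ g.dom).map a : g.dom ⟶ starQ X) = QDist.col p.left a := by
    refine hom_ext fun x c => ?_
    cases c
    exact congrFun (congrFun (congrArg (fun (φ : QDistributor f.dom g.dom) x y => φ.val x y)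
      (Category.comp_id p.left)) x) a
  -- closing the representable before or after composing with `ζ` gives the same closed presheaf
  have h2 : ((MMap p).map (MCat.unit g.hom a)).1 = isbell f.hom (QDist.col p.left a) := by
    rw [← h1]
    exact le_antisymm ((isbell_mono _ (comp_isbell_le p _)).trans (isbell_isbell _ _).le)
      (isbell_mono _ (comp_mono le_rfl (le_isbell _ _)))
  change _ ↔ k ≤ (presheaf f.dom).hom ((MMap p).map (MCat.unit g.hom a)).1 _
  rw [h2, presheaf_hom_isbell _ (MCat.col f.hom b).2, le_presheaf_hom, comp_ofArrow_le,
    le_lda_val]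
  rfl

theorem MMap_eq_iff {f g : ChuCon (QDist Q)} (p q : f ⟶ g) :
    MMap p = MMap q ↔ lda f.hom p.left = lda f.hom q.left := by
  constructor
  · intro h
    refine hom_ext fun a b => ?_
    rw [lda_val_eq_MCat_hom, lda_val_eq_MCat_hom, h]
  · intro h
    refine QFunctor.ext ?_
    funext X μ
    refine Subtype.ext ?_
    change rda (lda f.hom (p.left ≫ μ.1)) f.hom = rda (lda f.hom (q.left ≫ μ.1)) f.hom
    rw [lda_comp, lda_comp, h]

/-! ### Every left adjoint between categories of closed presheaves comes from a Chu connection -/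

/-- For `G ⊣ R`, the Chu connection has as `ζ(-, a)` the value of `G` at the closure of the
representable at `a`, and as `η(b, -)` the implication `ψ ↙ R(φ(-, b))`. -/
theorem exists_MMap_eq {f g : ChuCon (QDist Q)} {G : QFunctor (MCat g.hom) (MCat f.hom)}
    (hG : G.IsLeftAdj) : ∃ p : f ⟶ g, MMap p = G := by
  obtain ⟨R, hR⟩ := hG
  let ζ : f.dom ⟶ g.dom :=
    { val := fun x a => (G.map (MCat.unit g.hom a)).1.val x StarObj.pt
      act := fun x x' a a' => by
        refine (comp_mono le_rfl ?_).trans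
          (act_left (G.map (MCat.unit g.hom a')).1 x x' StarObj.pt)
        have h : g.dom.hom a a' ≤ (MCat f.hom).hom (G.map (MCat.unit g.hom a))
            (G.map (MCat.unit g.hom a')) := by
          refine le_trans ?_ (G.hom_le _ _)
          rw [MCat.hom_unit]
          exact le_isbell g.hom ((yonedaQ g.dom).map a') _ _ a StarObj.pt
        exact comp_ofArrow_le.mp (le_MCat_hom.mp h) x }
  let η : f.cod ⟶ g.cod :=
    { val := fun b c => (lda g.hom (R.map (MCat.col f.hom b)).1).val StarObj.pt c
      act := fun b b' c c' => by
        have h : f.cod.hom b' b ≤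
            (MCat g.hom).hom (R.map (MCat.col f.hom b')) (R.map (MCat.col f.hom b)) := by
          refine le_trans ?_ (R.hom_le _ _)
          rw [le_MCat_hom, comp_ofArrow_le]
          exact fun x => act_right f.hom x b' b
        rw [le_lda_val]
        intro Z a
        rw [← Category.assoc]
        refine (comp_mono (comp_ofArrow_le.mp (le_MCat_hom.mp h) a)
          (act_right (lda g.hom (R.map (MCat.col f.hom b)).1) StarObj.pt c c')).trans ?_
        exact le_lda_val.mp le_rfl a }
  have hval : ∀ {X Y : Q} (ν : (MCat f.hom).obj Y) (a : g.dom.obj X) (k : X ⟶ Y),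
      k ≤ (R.map ν).1.val a StarObj.pt ↔
        ∀ {Z : Q} (x : f.dom.obj Z), ζ.val x a ≫ k ≤ ν.1.val x StarObj.pt := by
    intro X Y ν a k
    rw [← MCat.hom_unit, ← hR.hom_eq, le_MCat_hom, comp_ofArrow_le]
  -- both implications have the entry `R(φ(-, b))(a)` at `(a, b)`
  have hζη : lda f.hom ζ = rda η g.hom := by
    refine hom_ext fun {X Y} a b => eq_of_forall_le_iff fun k => ?_
    have h1 : k ≤ (lda f.hom ζ).val a b ↔
        k ≤ (R.map (MCat.col f.hom b)).1.val a StarObj.pt :=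
      le_lda_val.trans (hval (MCat.col f.hom b) a k).symm
    have h2 : k ≤ (rda η g.hom).val a b ↔
        k ≤ (R.map (MCat.col f.hom b)).1.val a StarObj.pt := by
      conv_rhs => rw [← (R.map (MCat.col f.hom b)).2]
      rw [isbell, le_rda_val, le_rda_val]
    rw [h1, h2]
  refine ⟨⟨ζ, η, hζη⟩, QFunctor.ext ?_⟩
  funext X μ
  -- a closed presheaf `ν` is above either side exactly when `μ ≤ R ν`
  have key : ∀ ν : (MCat f.hom).obj X,
      isbell f.hom (ζ ≫ μ.1) ≤ ν.1 ↔ (G.map μ).1 ≤ ν.1 := by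
    intro ν
    have e : (G.map μ).1 ≤ ν.1 ↔ μ.1 ≤ (R.map ν).1 := by
      rw [← MCat_Le, ← MCat_Le, QCategory.Le, QCategory.Le, hR.hom_eq]
    rw [isbell_le_iff ν.2, e, comp_le_iff]
    constructor
    · intro h Y W a c
      cases c
      exact (hval ν a _).mpr fun x => h x a StarObj.pt
    · intro h Z Y W x a c
      cases c
      exact (hval ν a _).mp (h Y _ a StarObj.pt) x
  exact Subtype.ext (le_antisymm ((key (G.map μ)).mpr le_rfl)
    ((key ⟨_, isbell_isbell _ _⟩).mp le_rfl))

/-! ### Every skeletal complete `Q`-category is a category of closed presheaves -/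

/-- The closed presheaves for the identity distributor on a complete `Q`-category are the
representable ones. -/
theorem isbell_id {A : QCategory Q} {sup : QFunctor (presheaf A) A} (h : sup.Adj (yonedaQ A))
    {X : Q} (μ : (A : QDist Q) ⟶ starQ X) :
    isbell (𝟙 (A : QDist Q)) μ = (yonedaQ A).map (sup.map μ) := by
  have h1 : ∀ {Y : Q} (b : A.obj Y),
      (lda (𝟙 (A : QDist Q)) μ).val StarObj.pt b = A.hom (sup.map μ) b := by
    intro Y b
    rw [h.hom_eq]
    refine eq_of_forall_le_iff fun k => ?_
    rw [le_lda_val, le_presheaf_hom, comp_ofArrow_le]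
    rfl
  refine hom_ext fun a c => ?_
  cases c
  refine eq_of_forall_le_iff fun k => ?_
  rw [isbell, le_rda_val, yonedaQ_val]
  simp only [h1, id_val]
  constructor
  · intro hk
    refine le_trans ?_ (hk (sup.map μ))
    simpa using comp_mono (le_refl k) (A.id_le (sup.map μ))
  · intro hk Z c
    exact (comp_mono hk le_rfl).trans (A.comp_le _ _ _)

theorem sup_yonedaQ {A : QCCat Q} {sup : QFunctor (presheaf A.cat) A.cat}
    (h : sup.Adj (yonedaQ A.cat)) {X : Q} (x : A.cat.obj X) :
    sup.map ((yonedaQ A.cat).map x) = x := by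
  refine A.skeletal _ _ (h.2 x) ?_
  exact presheaf_Le.mp (h.1 ((yonedaQ A.cat).map x)) _ _ x StarObj.pt |>.trans' (A.cat.id_le x)

/-- `M` of the identity distributor on `A` consists of the representable presheaves, a copy of `A`
by the Yoneda embedding because `A` is skeletal. -/
theorem nonempty_iso_MFunctor_id (A : QCCat Q) :
    Nonempty ((MFunctor Q).obj (op ⟨𝟙 (A.cat : QDist Q)⟩) ≅ A) := by
  obtain ⟨sup, h⟩ := A.complete
  let S : QFunctor (MCat (𝟙 (A.cat : QDist Q))) A.cat :=
    ⟨fun μ => sup.map μ.1, fun μ ν => sup.hom_le _ _⟩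
  let T : QFunctor A.cat (MCat (𝟙 (A.cat : QDist Q))) :=
    ⟨fun x => ⟨(yonedaQ A.cat).map x, by rw [isbell_id h, sup_yonedaQ h]⟩,
      fun x y => (yonedaQ A.cat).hom_le x y⟩
  have hST : ∀ {X : Q} (x : A.cat.obj X), S.map (T.map x) = x := fun x => sup_yonedaQ h x
  have hTS : ∀ {X : Q} (μ : (MCat (𝟙 (A.cat : QDist Q))).obj X), T.map (S.map μ) = μ :=
    fun μ => Subtype.ext ((isbell_id h μ.1).symm.trans μ.2)
  refine ⟨⟨⟨S, T, fun μ => ?_, fun x => ?_⟩, ⟨T, S, fun x => ?_, fun μ => ?_⟩,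
    QCCat.hom_ext fun μ => hTS μ, QCCat.hom_ext fun x => hST x⟩⟩
  · exact (MCat_Le (φ := 𝟙 (A.cat : QDist Q))).mpr (congrArg Subtype.val (hTS μ)).ge
  · rw [hST]; exact QCategory.Le.refl x
  · rw [hST]; exact QCategory.Le.refl x
  · exact (MCat_Le (φ := 𝟙 (A.cat : QDist Q))).mpr (congrArg Subtype.val (hTS μ)).le

/-! ### The functor on back diagonals -/

theorem MFunctor_map_eq_iff {f g : ChuCon (QDist Q)} (p q : f ⟶ g) :
    (MFunctor Q).map p.op = (MFunctor Q).map q.op ↔ lda f.hom p.left = lda f.hom q.left :=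
  Subtype.ext_iff.trans (MMap_eq_iff p q)

theorem MFunctor_map_sSup {f g : ChuCon (QDist Q)} (S : Set (f ⟶ g)) :
    (MFunctor Q).map (sSup S).op = sSup ((fun p : f ⟶ g => (MFunctor Q).map p.op) '' S) := by
  refine QCCat.hom_ext fun μ => QCCat.eq_of_hom_eq fun ν => ?_
  have h : ∀ p : f ⟶ g, ∀ {X Y : Q} (μ : (MCat g.hom).obj X) (ν : (MCat f.hom).obj Y) (k : X ⟶ Y),
      k ≤ (MCat f.hom).hom ((MMap p).map μ) ν ↔ p.left ≫ μ.1 ≫ ofArrow k ≤ ν.1 := by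
    intro p X Y μ ν k
    change k ≤ (presheaf f.dom).hom (isbell f.hom (p.left ≫ μ.1)) ν.1 ↔ _
    rw [presheaf_hom_isbell _ ν.2, le_presheaf_hom, Category.assoc]
  rw [QCCat.sSup_hom, iInf_image]
  refine eq_of_forall_le_iff fun k => ?_
  rw [le_iInf₂_iff]
  refine (h (sSup S) μ ν k).trans ?_
  rw [ChuCon.sSup_left, sSup_comp]
  simp only [sSup_le_iff, Set.forall_mem_image]
  exact forall₂_congr fun p _ => (h p μ ν k).symm

variable (Q) in
/-- The functor induced by `MFunctor` on back diagonals. -/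
def MbFunctor : (BackDiag (QDist Q))ᵒᵖ ⥤ QCCat Q :=
  (backDiagonalCongruence (QDist Q)).descOp (MFunctor Q) fun p q => (MFunctor_map_eq_iff p q).mpr

theorem MbFunctor_isQuantaloidHom : IsQuantaloidHom (MbFunctor Q) := by
  intro X Y S
  -- a join of classes is the class of the join of their largest members
  change (MFunctor Q).map (sSup (Congruence.largest '' (Quiver.Hom.unop '' S))).op = _
  rw [MFunctor_map_sSup, Set.image_image, Set.image_image]
  congr 1
  refine Set.image_congr fun p _ => ?_
  conv_rhs => rw [← p.op_unop, ← Congruence.cls_largest p.unop]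
  rfl

instance : (MbFunctor Q).Faithful where
  map_injective {X Y} p q h := by
    obtain ⟨p', hp⟩ := Congruence.cls_surjective p.unop
    obtain ⟨q', hq⟩ := Congruence.cls_surjective q.unop
    refine Quiver.Hom.unop_inj ?_
    obtain rfl : p = (Congruence.cls _ p').op := Quiver.Hom.unop_inj hp.symm
    obtain rfl : q = (Congruence.cls _ q').op := Quiver.Hom.unop_inj hq.symm
    exact Congruence.cls_eq_iff.mpr ((MFunctor_map_eq_iff p' q').mp h)

instance : (MbFunctor Q).Full where
  map_surjective {X Y} G := by
    obtain ⟨p, hp⟩ := exists_MMap_eq G.2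
    exact ⟨(Congruence.cls _ p).op, Subtype.ext hp⟩

instance : (MbFunctor Q).EssSurj where
  mem_essImage A := ⟨op ⟨⟨𝟙 (A.cat : QDist Q)⟩⟩, nonempty_iso_MFunctor_id A⟩

instance : (MbFunctor Q).IsEquivalence where

end

theorem theorem3p10 (Q : Type u) [SmallCategory Q] [Quantaloid Q] :
    (∃ Mb : (BackDiag (QDist Q))ᵒᵖ ⥤ QCCat Q,
      (toBackDiag (QDist Q)).op ⋙ Mb = MFunctor Q ∧
      (∀ F : (BackDiag (QDist Q))ᵒᵖ ⥤ QCCat Q,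
        (toBackDiag (QDist Q)).op ⋙ F = MFunctor Q → F = Mb) ∧
      IsQuantaloidEquivalence Mb) ∧
    ∃ e : (BackDiag (QDist Q))ᵒᵖ ≌ QCCat Q,
      IsQuantaloidHom e.functor ∧ IsQuantaloidHom e.inverse := by
  refine ⟨⟨MbFunctor Q, rfl, fun F hF => ?_, MbFunctor_isQuantaloidHom, inferInstance⟩,
    (MbFunctor Q).asEquivalence, MbFunctor_isQuantaloidHom,
    isQuantaloidHom_inverse _ MbFunctor_isQuantaloidHom⟩
  exact Congruence.eq_of_quotientFunctor_op_comp_eq _ hF
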